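/- Let $n\ge 3$ and $d\ge 2$, and let $\lambda_1,\dots,\lambda_{d^2-1}$ be generators of $SU(d)$, that is, $d\times d$ complex matrices with $\lambda_i^\dagger=\lambda_i$, $\operatorname{Tr}\lambda_i=0$ and $\operatorname{Tr}(\lambda_i\lambda_j)=2\delta_{ij}$. For an $n$-qudit pure state, i.e. a unit vector $|\psi\rangle\in(\mathbb C^d)^{\otimes n}$ with $\rho=|\psi\rangle\langle\psi|$, let $\mathbf T^{(1\cdots n)}$ be the vector with entries $t_{i_1\cdots i_n}=\operatorname{Tr}\big(\rho\,\lambda_{i_1}\otimes\cdots\otimes\lambda_{i_n}\big)$, $1\le i_1,\dots,i_n\le d^2-1$, let $\|\cdot\|$ be the Euclidean norm, and let $$E_{\mathbf T}(|\psi\rangle)=\Big(\frac d2\Big)^{n/2}\big\|\mathbf T^{(1\cdots n)}\big\|-\Big(\frac{d(d-1)}2\Big)^{n/2}.$$ Then $$E_{\mathbf T}(|\psi\rangle)\le\Big(\frac d2\Big)^{n/2}\left[\sqrt{d^n-\frac{n}{n-2}d^{n-2}+\frac{2}{n-2}}-(d-1)^{n/2}\right].$$ Moreover, the same upper bound holds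 for the normalization $\big(\frac d2\big)^{n}\big\|\mathbf T^{(1\cdots n)}\big\|-\big(\frac{d(d-1)}2\big)^{n/2}$ of the measure, in which the prefactor is $(d/2)^n$ in place of $(d/2)^{n/2}$. -/

import Mathlib

/-- `lam 0, …, lam (d² - 2)` is a system of (Hermitian) generators of `SU(d)` with the usual
normalization: Hermitian, traceless, `Tr (lam i * lam j) = 2 δ i j`.
(The generalized Gell-Mann matrices are an example.) -/
structure IsSUGenerators (d : ℕ) (lam : Fin (d ^ 2 - 1) → Matrix (Fin d) (Fin d) ℂ) : Prop where
  isHermitian : ∀ i, (lam i).IsHermitian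
  trace_eq_zero : ∀ i, (lam i).trace = 0
  trace_mul : ∀ i j, (lam i * lam j).trace = if i = j then 2 else 0

/-- The tensor (Kronecker) product `A 0 ⊗ A 1 ⊗ ⋯ ⊗ A (n - 1)` of `n` operators on `ℂ^d`, as a
matrix in the product basis of `(ℂ^d)^{⊗ n}`, which is indexed by `Fin n → Fin d`. -/
def tensorMatrix {n d : ℕ} (A : Fin n → Matrix (Fin d) (Fin d) ℂ) :
    Matrix (Fin n → Fin d) (Fin n → Fin d) ℂ :=
  Matrix.of fun a b => ∏ k, A k (a k) (b k)

/-- The operator `|ψ⟩⟨ψ|` of a vector `ψ` of `(ℂ^d)^{⊗ n}`. -/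
def pureState {n d : ℕ} (ψ : EuclideanSpace ℂ (Fin n → Fin d)) :
    Matrix (Fin n → Fin d) (Fin n → Fin d) ℂ :=
  Matrix.of fun a b => ψ a * star (ψ b)

/-- The Bloch vector (full correlation tensor) `T^{(1⋯n)}` of an operator `ρ` on `(ℂ^d)^{⊗ n}`, with
entries `Tr (ρ (lam i₁ ⊗ ⋯ ⊗ lam iₙ))`; its norm is the Euclidean one. The entries are kept as
complex numbers, and they have zero imaginary part when `ρ` and all `lam i` are Hermitian. -/
noncomputable def blochVector {n d : ℕ} (lam : Fin (d ^ 2 - 1) → Matrix (Fin d) (Fin d) ℂ)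
    (ρ : Matrix (Fin n → Fin d) (Fin n → Fin d) ℂ) :
    EuclideanSpace ℂ (Fin n → Fin (d ^ 2 - 1)) :=
  WithLp.toLp 2 fun i => (ρ * tensorMatrix fun k => lam (i k)).trace

/-- The entanglement measure
`E_T(|ψ⟩) = (d/2)^{n/2} ‖T^{(1⋯n)}‖ - (d(d-1)/2)^{n/2}`. -/
noncomputable def entanglementMeasure {n d : ℕ}
    (lam : Fin (d ^ 2 - 1) → Matrix (Fin d) (Fin d) ℂ)
    (ψ : EuclideanSpace ℂ (Fin n → Fin d)) : ℝ :=
  ((d : ℝ) / 2) ^ ((n : ℝ) / 2) * ‖blochVector lam (pureState ψ)‖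
    - ((d : ℝ) * ((d : ℝ) - 1) / 2) ^ ((n : ℝ) / 2)

/-- The same measure with the Bloch vector normalized as the coefficient tensor `(d/2)^n T^{(1⋯n)}`
in `ρ = d^{-n} (I + ⋯ + ∑ (d/2)^n t_{i₁⋯iₙ} lam i₁ ⊗ ⋯ ⊗ lam iₙ)`, that is
`(d/2)^n ‖T^{(1⋯n)}‖ - (d(d-1)/2)^{n/2}`, which vanishes on product states. -/
noncomputable def entanglementMeasureNormalized {n d : ℕ}
    (lam : Fin (d ^ 2 - 1) → Matrix (Fin d) (Fin d) ℂ)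
    (ψ : EuclideanSpace ℂ (Fin n → Fin d)) : ℝ :=
  ((d : ℝ) / 2) ^ n * ‖blochVector lam (pureState ψ)‖
    - ((d : ℝ) * ((d : ℝ) - 1) / 2) ^ ((n : ℝ) / 2)

/-- The bound `(d/2)^{n/2} [√(d^n - n/(n-2) d^{n-2} + 2/(n-2)) - (d-1)^{n/2}]`, used for `n ≥ 3`. -/
noncomputable def entanglementBound (n d : ℕ) : ℝ :=
  ((d : ℝ) / 2) ^ ((n : ℝ) / 2) *
    (√((d : ℝ) ^ n - (n : ℝ) / ((n : ℝ) - 2) * (d : ℝ) ^ (n - 2) + 2 / ((n : ℝ) - 2))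
      - ((d : ℝ) - 1) ^ ((n : ℝ) / 2))

open Matrix Finset ComplexConjugate

/-! Expand |ψ⟩⟨ψ| in tensor products of `operatorBasis` and let A_j be the sum of the squared moduli
of the correlations with exactly j non-identity factors; up to scaling, A_n is ‖T‖². The
correlations supported in F sum to d^|F| times the purity of the reduction to F
(`sum_normSq_correlation`), and complementary reductions of a pure state have equal purity
(`purity_compl`). Hence ∑ A_j = d^n and ∑ (n - j) A_j = d^(n-2) Q, where Q = n A_0 + A_1 and A_0 =
1. A linear combination of these identities (`count_supports`), together with Q ≥ n, bounds A_n. -/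

/-- The identity together with the rescaled generators `√(d/2) lam i`: an orthogonal basis of the
`d × d` matrices in which every element has squared Hilbert–Schmidt norm `d`. -/
noncomputable def operatorBasis {d : ℕ} (lam : Fin (d ^ 2 - 1) → Matrix (Fin d) (Fin d) ℂ) :
    Option (Fin (d ^ 2 - 1)) → Matrix (Fin d) (Fin d) ℂ
  | none => 1
  | some i => ((√((d : ℝ) / 2) : ℝ) : ℂ) • lam i

/-! ### Orthogonality and completeness of the local operator basis -/

section OperatorBasis

variable {d : ℕ} {lam : Fin (d ^ 2 - 1) → Matrix (Fin d) (Fin d) ℂ}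

lemma operatorBasis_isHermitian (hlam : IsSUGenerators d lam) (i : Option (Fin (d ^ 2 - 1))) :
    (operatorBasis lam i).IsHermitian := by
  cases i with
  | none => exact Matrix.isHermitian_one
  | some i =>
    simp only [operatorBasis, Matrix.IsHermitian, Matrix.conjTranspose_smul]
    rw [hlam.isHermitian i]
    simp

lemma operatorBasis_trace_mul (hlam : IsSUGenerators d lam) (i j : Option (Fin (d ^ 2 - 1))) :
    (operatorBasis lam i * operatorBasis lam j).trace = if i = j then (d : ℂ) else 0 := by
  have hs : ((√((d : ℝ) / 2) : ℝ) : ℂ) * ((√((d : ℝ) / 2) : ℝ) : ℂ) = (d : ℂ) / 2 := by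
    rw [← Complex.ofReal_mul, Real.mul_self_sqrt (by positivity)]
    push_cast
    rfl
  cases i with
  | none =>
    cases j with
    | none => simp [operatorBasis]
    | some j => simp [operatorBasis, hlam.trace_eq_zero j]
  | some i =>
    cases j with
    | none => simp [operatorBasis, hlam.trace_eq_zero i]
    | some j =>
      simp only [operatorBasis, Matrix.smul_mul, Matrix.mul_smul, Matrix.trace_smul, smul_eq_mul,
        hlam.trace_mul, Option.some.injEq]
      rw [← mul_assoc, hs]
      split_ifs <;> simp

/-- Completeness relation of the operator basis. -/
lemma operatorBasis_completeness (hd : 1 ≤ d) (hlam : IsSUGenerators d lam)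
    (a b a' b' : Fin d) :
    ∑ i, operatorBasis lam i b a * conj (operatorBasis lam i b' a') =
      (d : ℂ) * ((if a = a' then 1 else 0) * (if b = b' then 1 else 0)) := by
  have hd0 : (d : ℂ) ≠ 0 := by exact_mod_cast (by omega : d ≠ 0)
  let M : Matrix (Option (Fin (d ^ 2 - 1))) (Fin d × Fin d) ℂ :=
    Matrix.of fun i p => operatorBasis lam i p.1 p.2
  -- Trace orthogonality says that the rows of M/√d are orthonormal. Since M is square, its columns
  -- are orthonormal too, which is completeness.
  have hM : M * ((d : ℂ)⁻¹ • Mᴴ) = 1 := by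
    ext i j
    have h := operatorBasis_trace_mul hlam i j
    have hH : ∀ x y, star (operatorBasis lam j x y) = operatorBasis lam j y x := fun x y =>
      (operatorBasis_isHermitian hlam j).apply y x
    simp only [Matrix.trace, Matrix.diag_apply, Matrix.mul_apply] at h
    simp only [M, Matrix.mul_apply, Matrix.smul_apply, Matrix.conjTranspose_apply, Matrix.of_apply,
      smul_eq_mul, Fintype.sum_prod_type, hH, Matrix.one_apply]
    calc _ = (d : ℂ)⁻¹ * ∑ x, ∑ y, operatorBasis lam i x y * operatorBasis lam j y x := by
          simp only [Finset.mul_sum]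
          exact Finset.sum_congr rfl fun x _ => Finset.sum_congr rfl fun y _ => by ring
      _ = _ := by
          rw [h]
          split_ifs <;> simp [hd0]
  have hcard : Fintype.card (Option (Fin (d ^ 2 - 1))) = Fintype.card (Fin d × Fin d) := by
    have : 1 ≤ d ^ 2 := Nat.one_le_pow _ _ hd
    simp only [Fintype.card_option, Fintype.card_fin, Fintype.card_prod]
    rw [← pow_two]
    omega
  have hM' := (Matrix.mul_eq_one_comm_of_card_eq _ _ _ hcard).mp hM
  have h := congrFun (congrFun hM' (b', a')) (b, a)
  simp only [M, Matrix.mul_apply, Matrix.smul_apply, Matrix.conjTranspose_apply, Matrix.of_apply,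
    smul_eq_mul, Matrix.one_apply, Prod.mk.injEq] at h
  calc _ = (d : ℂ) * ∑ i, (d : ℂ)⁻¹ * star (operatorBasis lam i b' a') *
        operatorBasis lam i b a := by
        rw [Finset.mul_sum]
        refine Finset.sum_congr rfl fun i _ => ?_
        rw [starRingEnd_apply]
        field_simp
    _ = _ := by
        rw [h, ite_and]
        by_cases h1 : a = a' <;> by_cases h2 : b = b' <;> simp [h1, h2, eq_comm]

end OperatorBasis

/-! ### Correlations and purities of reductions -/

section Correlation

variable {n d : ℕ}

/-- The expectation of the product operator `⨂ₖ operatorBasis lam (i k)` in the state `ψ`. -/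
noncomputable def correlation (lam : Fin (d ^ 2 - 1) → Matrix (Fin d) (Fin d) ℂ)
    (ψ : EuclideanSpace ℂ (Fin n → Fin d)) (i : Fin n → Option (Fin (d ^ 2 - 1))) : ℂ :=
  (pureState ψ * tensorMatrix fun k => operatorBasis lam (i k)).trace

/-- The purity of the reduction of `|ψ⟩⟨ψ|` to the sites in `F`, written as a contraction of two
copies of `|ψ⟩⟨ψ|`. -/
noncomputable def purity (ψ : EuclideanSpace ℂ (Fin n → Fin d)) (F : Finset (Fin n)) : ℂ :=
  ∑ a, ∑ b, ∑ a', ∑ b', ψ a * conj (ψ b) * conj (ψ a') * ψ b' *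
    ∏ k, if k ∈ F then ((if a k = a' k then 1 else 0) * (if b k = b' k then 1 else 0) : ℂ)
      else ((if a k = b k then 1 else 0) * (if a' k = b' k then 1 else 0))

/-- Complementary reductions of a pure state have the same purity. -/
lemma purity_compl (ψ : EuclideanSpace ℂ (Fin n → Fin d)) (F : Finset (Fin n)) :
    purity ψ Fᶜ = purity ψ F := by
  unfold purity
  refine Finset.sum_congr rfl fun a _ => ?_
  -- Exchanging the names b and a' swaps the two contraction patterns and fixes the product of
  -- amplitudes.
  rw [Finset.sum_comm]
  refine Finset.sum_congr rfl fun b _ => Finset.sum_congr rfl fun a' _ =>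
    Finset.sum_congr rfl fun b' _ => ?_
  congr 1
  · ring
  · refine Finset.prod_congr rfl fun k _ => ?_
    by_cases hk : k ∈ F <;> simp [hk]

/-- The Bloch indices which vanish outside of `F`. -/
def supportedOn (d : ℕ) (F : Finset (Fin n)) : Finset (Fin n → Option (Fin (d ^ 2 - 1))) :=
  Fintype.piFinset fun k => if k ∈ F then univ else {none}

lemma mem_supportedOn {F : Finset (Fin n)} {i : Fin n → Option (Fin (d ^ 2 - 1))} :
    i ∈ supportedOn d F ↔ ∀ k, k ∉ F → i k = none := by
  simp only [supportedOn, Fintype.mem_piFinset]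
  refine forall_congr' fun k => ?_
  by_cases hk : k ∈ F <;> simp [hk]

variable {lam : Fin (d ^ 2 - 1) → Matrix (Fin d) (Fin d) ℂ}

lemma correlation_eq_sum (ψ : EuclideanSpace ℂ (Fin n → Fin d))
    (i : Fin n → Option (Fin (d ^ 2 - 1))) :
    correlation lam ψ i =
      ∑ a, ∑ b, ψ a * conj (ψ b) * ∏ k, operatorBasis lam (i k) (b k) (a k) := by
  simp [correlation, Matrix.trace, Matrix.mul_apply, pureState, tensorMatrix]

/-- The sum factorizes over sites: completeness gives a factor d at each site of F, and only the
identity survives elsewhere. -/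
lemma sum_prod_operatorBasis (hd : 1 ≤ d) (hlam : IsSUGenerators d lam) (F : Finset (Fin n))
    (a b a' b' : Fin n → Fin d) :
    ∑ i ∈ supportedOn d F, ∏ k, (operatorBasis lam (i k) (b k) (a k) *
        conj (operatorBasis lam (i k) (b' k) (a' k))) =
      (d : ℂ) ^ #F * ∏ k, if k ∈ F then
        ((if a k = a' k then 1 else 0) * (if b k = b' k then 1 else 0) : ℂ)
      else ((if a k = b k then 1 else 0) * (if a' k = b' k then 1 else 0)) := by
  have hpow : (d : ℂ) ^ #F = ∏ k, if k ∈ F then (d : ℂ) else 1 := by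
    rw [Finset.prod_ite_mem, Finset.univ_inter, Finset.prod_const]
  rw [supportedOn, ← Finset.prod_univ_sum (fun k => if k ∈ F then univ else {none})
    (fun k x => operatorBasis lam x (b k) (a k) * conj (operatorBasis lam x (b' k) (a' k))),
    hpow, ← Finset.prod_mul_distrib]
  refine Finset.prod_congr rfl fun k _ => ?_
  by_cases hk : k ∈ F
  · simp only [hk, if_true]
    exact operatorBasis_completeness hd hlam _ _ _ _
  · simp only [hk, if_false, Finset.sum_singleton, operatorBasis, Matrix.one_apply, one_mul]
    by_cases h1 : a k = b k <;> by_cases h2 : a' k = b' k <;> simp [h1, h2, eq_comm]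

/-- The correlations inside `F` determine the purity of the reduction to `F`. -/
lemma sum_normSq_correlation (hd : 1 ≤ d) (hlam : IsSUGenerators d lam)
    (ψ : EuclideanSpace ℂ (Fin n → Fin d)) (F : Finset (Fin n)) :
    ((∑ i ∈ supportedOn d F, Complex.normSq (correlation lam ψ i) : ℝ) : ℂ) =
      (d : ℂ) ^ #F * purity ψ F := by
  have hterm : ∀ i, ((Complex.normSq (correlation lam ψ i) : ℝ) : ℂ) =
      ∑ a, ∑ b, ∑ a', ∑ b', ψ a * conj (ψ b) * conj (ψ a') * ψ b' *
        ∏ k, (operatorBasis lam (i k) (b k) (a k) *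
          conj (operatorBasis lam (i k) (b' k) (a' k))) := by
    intro i
    rw [← Complex.mul_conj, correlation_eq_sum]
    simp only [map_sum, map_mul, map_prod, Complex.conj_conj, Finset.sum_mul]
    refine Finset.sum_congr rfl fun a _ => Finset.sum_congr rfl fun b _ => ?_
    simp only [Finset.mul_sum]
    refine Finset.sum_congr rfl fun a' _ => Finset.sum_congr rfl fun b' _ => ?_
    rw [Finset.prod_mul_distrib]
    ring
  rw [Complex.ofReal_sum, Finset.sum_congr rfl fun i _ => hterm i, purity, Finset.sum_comm,
    Finset.mul_sum]
  refine Finset.sum_congr rfl fun a _ => ?_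
  rw [Finset.sum_comm, Finset.mul_sum]
  refine Finset.sum_congr rfl fun b _ => ?_
  rw [Finset.sum_comm, Finset.mul_sum]
  refine Finset.sum_congr rfl fun a' _ => ?_
  rw [Finset.sum_comm, Finset.mul_sum]
  refine Finset.sum_congr rfl fun b' _ => ?_
  rw [← Finset.mul_sum, sum_prod_operatorBasis hd hlam]
  ring

lemma correlation_none (ψ : EuclideanSpace ℂ (Fin n → Fin d)) (hψ : ‖ψ‖ = 1) :
    correlation lam ψ (fun _ => none) = 1 := by
  have htensor : (tensorMatrix fun k : Fin n => operatorBasis lam ((fun _ => none) k)) = 1 := by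
    ext a b
    simp only [tensorMatrix, operatorBasis, Matrix.of_apply, Matrix.one_apply,
      Finset.prod_ite_zero, Finset.prod_const_one]
    simp [funext_iff]
  rw [correlation, htensor, Matrix.mul_one]
  have h := EuclideanSpace.norm_sq_eq ψ
  rw [hψ] at h
  simp only [Matrix.trace, Matrix.diag_apply, pureState, Matrix.of_apply]
  have h2 : ∀ a, ψ a * star (ψ a) = ((‖ψ a‖ ^ 2 : ℝ) : ℂ) := fun a => by
    rw [Complex.star_def, Complex.mul_conj, Complex.normSq_eq_norm_sq]
  simp only [h2]
  rw [← Complex.ofReal_sum, ← h]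
  simp

lemma supportedOn_empty : supportedOn d (∅ : Finset (Fin n)) = {fun _ => none} := by
  ext i
  simp [mem_supportedOn, funext_iff]

lemma supportedOn_univ : supportedOn d (univ : Finset (Fin n)) = univ := by
  ext i
  simp [mem_supportedOn]

lemma purity_empty (hd : 1 ≤ d) (hlam : IsSUGenerators d lam)
    (ψ : EuclideanSpace ℂ (Fin n → Fin d)) (hψ : ‖ψ‖ = 1) : purity ψ ∅ = 1 := by
  have h := sum_normSq_correlation hd hlam ψ ∅
  rw [supportedOn_empty, Finset.sum_singleton, correlation_none ψ hψ] at h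
  simpa using h.symm

/-- The full state has the purity of the empty reduction, which is 1. -/
lemma sum_normSq_correlation_univ (hd : 1 ≤ d) (hlam : IsSUGenerators d lam)
    (ψ : EuclideanSpace ℂ (Fin n → Fin d)) (hψ : ‖ψ‖ = 1) :
    ∑ i, Complex.normSq (correlation lam ψ i) = (d : ℝ) ^ n := by
  have h := sum_normSq_correlation hd hlam ψ univ
  rw [supportedOn_univ, ← purity_compl, Finset.compl_univ, purity_empty hd hlam ψ hψ] at h
  simp only [Finset.card_univ, Fintype.card_fin, mul_one] at h
  exact_mod_cast h

/-- Correlations avoiding the site `k` against those at `k` only. -/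
lemma sum_normSq_correlation_compl_singleton (hn : 2 ≤ n) (hd : 1 ≤ d)
    (hlam : IsSUGenerators d lam) (ψ : EuclideanSpace ℂ (Fin n → Fin d)) (k : Fin n) :
    ∑ i ∈ supportedOn d {k}ᶜ, Complex.normSq (correlation lam ψ i) =
      (d : ℝ) ^ (n - 2) * ∑ i ∈ supportedOn d {k}, Complex.normSq (correlation lam ψ i) := by
  have h1 := sum_normSq_correlation hd hlam ψ {k}ᶜ
  have h2 := sum_normSq_correlation hd hlam ψ {k}
  rw [purity_compl, Finset.card_compl, Finset.card_singleton, Fintype.card_fin] at h1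
  rw [Finset.card_singleton, pow_one] at h2
  apply Complex.ofReal_injective
  rw [h1, Complex.ofReal_mul, h2, show n - 1 = n - 2 + 1 by omega, pow_succ]
  push_cast
  ring

/-! ### Weight count and the bound on full correlations -/

/-- Weight count behind the bound on the full correlations. -/
lemma count_supports (hn : 3 ≤ n) (i : Fin n → Option (Fin (d ^ 2 - 1))) :
    ((n : ℝ) - 2) * (if ∀ k, i k ≠ none then 1 else 0) +
        ∑ k, (if i ∈ supportedOn d {k}ᶜ then (1 : ℝ) else 0) +
        ((n : ℝ) - 2) * (if i = fun _ => none then 1 else 0) ≤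
      ((n : ℝ) - 2) + ∑ k, (if i ∈ supportedOn d {k} then (1 : ℝ) else 0) := by
  have hn' : (3 : ℝ) ≤ n := by exact_mod_cast hn
  have hcompl : ∀ k, i ∈ supportedOn d {k}ᶜ ↔ i k = none := fun k => by simp [mem_supportedOn]
  have hnonneg : (0 : ℝ) ≤ ∑ k, (if i ∈ supportedOn d {k} then (1 : ℝ) else 0) :=
    Finset.sum_nonneg fun k _ => by split_ifs <;> norm_num
  have hcount : ∑ k, (if i ∈ supportedOn d {k}ᶜ then (1 : ℝ) else 0) =
      n - #{k | i k ≠ none} := by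
    have h := Finset.card_filter_add_card_filter_not (s := (univ : Finset (Fin n)))
      (fun k => i k = none)
    rw [Finset.card_univ, Fintype.card_fin] at h
    simp only [hcompl, Finset.sum_boole]
    exact eq_sub_of_add_eq (by exact_mod_cast h)
  rw [hcount]
  -- Cases by the number of non-identity factors. Equality holds for 0, 1, 2 and n of them;
  -- otherwise the left side is smaller.
  by_cases h0 : i = fun _ => none
  · subst h0
    have hnfull : ¬ ∀ k : Fin n, (none : Option (Fin (d ^ 2 - 1))) ≠ none := fun h =>
      h ⟨0, by omega⟩ rfl
    rw [if_neg hnfull]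
    simp [mem_supportedOn]
    linarith
  · by_cases hfull : ∀ k, i k ≠ none
    · have hc : #{k | i k ≠ none} = n := by simp [hfull]
      rw [if_pos hfull, if_neg h0, hc]
      linarith
    · rw [if_neg hfull, if_neg h0]
      obtain ⟨k, hk⟩ := Function.ne_iff.mp h0
      by_cases h1 : #{k | i k ≠ none} = 1
      · have hle : (1 : ℝ) ≤ ∑ k, (if i ∈ supportedOn d {k} then (1 : ℝ) else 0) := by
          have hmem : i ∈ supportedOn d {k} := by
            rw [mem_supportedOn]
            intro j hj
            by_contra hij
            exact hj (Finset.mem_singleton.mpr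
              (Finset.card_le_one.mp h1.le j (by simp [hij]) k (by simp [hk])))
          calc (1 : ℝ) = if i ∈ supportedOn d {k} then (1 : ℝ) else 0 := by rw [if_pos hmem]
            _ ≤ _ := Finset.single_le_sum
              (f := fun k => if i ∈ supportedOn d {k} then (1 : ℝ) else 0)
              (fun k _ => by split_ifs <;> norm_num) (Finset.mem_univ k)
        rw [h1]
        push_cast
        linarith
      · have hpos : 0 < #{k | i k ≠ none} := Finset.card_pos.mpr ⟨k, by simp [hk]⟩
        have h2 : (2 : ℝ) ≤ #{k | i k ≠ none} := by
          exact_mod_cast (by omega : 2 ≤ #{k | i k ≠ none})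
        linarith

/-- Averaging `count_supports` against the squared correlations gives (n-2) A_n + d^(n-2) Q + (n-2)
≤ (n-2) d^n + Q. -/
lemma full_correlation_le (hn : 3 ≤ n) (hd : 1 ≤ d) (hlam : IsSUGenerators d lam)
    (ψ : EuclideanSpace ℂ (Fin n → Fin d)) (hψ : ‖ψ‖ = 1) :
    ∑ i with ∀ k, i k ≠ none, Complex.normSq (correlation lam ψ i) ≤
      (d : ℝ) ^ n - (n : ℝ) / ((n : ℝ) - 2) * (d : ℝ) ^ (n - 2) + 2 / ((n : ℝ) - 2) := by
  have hn' : (0 : ℝ) < (n : ℝ) - 2 := by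
    have : (3 : ℝ) ≤ n := by exact_mod_cast hn
    linarith
  set w : (Fin n → Option (Fin (d ^ 2 - 1))) → ℝ :=
    fun i => Complex.normSq (correlation lam ψ i) with hw
  have hw0 : ∀ i, 0 ≤ w i := fun i => Complex.normSq_nonneg _
  have hnone : w (fun _ => none) = 1 := by simp [hw, correlation_none ψ hψ]
  have htotal : ∑ i, w i = (d : ℝ) ^ n := sum_normSq_correlation_univ hd hlam ψ hψ
  set Q := ∑ k, ∑ i ∈ supportedOn d {k}, w i with hQ
  -- Each of the n inner sums contains the all-identity term, which is 1.
  have hQn : (n : ℝ) ≤ Q := by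
    have : ∀ k ∈ (univ : Finset (Fin n)), (1 : ℝ) ≤ ∑ i ∈ supportedOn d {k}, w i := fun k _ => by
      rw [← hnone]
      exact Finset.single_le_sum (fun i _ => hw0 i) (by simp [mem_supportedOn])
    simpa using Finset.card_nsmul_le_sum _ _ _ this
  have hcompl : ∑ k, ∑ i ∈ supportedOn d {k}ᶜ, w i = (d : ℝ) ^ (n - 2) * Q := by
    rw [hQ, Finset.mul_sum]
    exact Finset.sum_congr rfl fun k _ =>
      sum_normSq_correlation_compl_singleton (by omega) hd hlam ψ k
  have hswap : ∀ S : Fin n → Finset (Fin n → Option (Fin (d ^ 2 - 1))),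
      ∑ i, (∑ k, if i ∈ S k then (1 : ℝ) else 0) * w i = ∑ k, ∑ i ∈ S k, w i := fun S => by
    simp only [Finset.sum_mul]
    rw [Finset.sum_comm]
    simp [ite_mul, Finset.sum_ite_mem]
  have hcount := Finset.sum_le_sum fun i (_ : i ∈ univ) =>
    mul_le_mul_of_nonneg_right (count_supports hn i) (hw0 i)
  simp only [add_mul, Finset.sum_add_distrib, hswap, mul_assoc, ← Finset.mul_sum, hcompl, htotal,
    ite_mul, one_mul, zero_mul, Finset.sum_ite_eq', Finset.mem_univ, if_true, hnone] at hcount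
  simp only [← Finset.sum_filter, ← hQ] at hcount
  have hpow : (1 : ℝ) ≤ (d : ℝ) ^ (n - 2) := one_le_pow₀ (by exact_mod_cast hd)
  -- Q enters the bound with coefficient 1 - d^(n-2) ≤ 0, so it may be replaced by its lower bound
  -- n.
  have hmul := mul_nonneg (sub_nonneg.mpr hpow) (sub_nonneg.mpr hQn)
  have hrhs : (d : ℝ) ^ n - (n : ℝ) / ((n : ℝ) - 2) * (d : ℝ) ^ (n - 2) + 2 / ((n : ℝ) - 2) =
      (((n : ℝ) - 2) * (d : ℝ) ^ n - n * (d : ℝ) ^ (n - 2) + 2) / ((n : ℝ) - 2) := by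
    field_simp
  rw [hrhs, le_div_iff₀ hn']
  linarith

/-! ### Back to the Bloch vector and the two measures -/

/-- The generators rescale the Bloch vector to the correlations on all sites. -/
lemma normSq_correlation_some (ψ : EuclideanSpace ℂ (Fin n → Fin d))
    (i : Fin n → Fin (d ^ 2 - 1)) :
    Complex.normSq (correlation lam ψ fun k => some (i k)) =
      ((d : ℝ) / 2) ^ n * ‖blochVector lam (pureState ψ) i‖ ^ 2 := by
  have htensor : (tensorMatrix fun k => operatorBasis lam (some (i k))) =
      ((√((d : ℝ) / 2) : ℝ) : ℂ) ^ n • tensorMatrix fun k => lam (i k) := by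
    ext a b
    simp only [tensorMatrix, operatorBasis, Matrix.of_apply, Matrix.smul_apply, smul_eq_mul,
      Finset.prod_mul_distrib, Finset.prod_const, Finset.card_univ, Fintype.card_fin]
  rw [correlation, htensor, Matrix.mul_smul, Matrix.trace_smul, smul_eq_mul, Complex.normSq_mul,
    map_pow, Complex.normSq_ofReal, Real.mul_self_sqrt (by positivity), Complex.normSq_eq_norm_sq]
  rfl

lemma norm_blochVector_sq_le (hn : 3 ≤ n) (hd : 1 ≤ d) (hlam : IsSUGenerators d lam)
    (ψ : EuclideanSpace ℂ (Fin n → Fin d)) (hψ : ‖ψ‖ = 1) :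
    ((d : ℝ) / 2) ^ n * ‖blochVector lam (pureState ψ)‖ ^ 2 ≤
      (d : ℝ) ^ n - (n : ℝ) / ((n : ℝ) - 2) * (d : ℝ) ^ (n - 2) + 2 / ((n : ℝ) - 2) := by
  refine le_trans ?_ (full_correlation_le hn hd hlam ψ hψ)
  rw [EuclideanSpace.norm_sq_eq, Finset.mul_sum]
  simp only [← normSq_correlation_some]
  let e : (Fin n → Fin (d ^ 2 - 1)) ↪ (Fin n → Option (Fin (d ^ 2 - 1))) :=
    ⟨fun i k => some (i k), fun i j h => funext fun k => Option.some_injective _ (congrFun h k)⟩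
  calc _ = ∑ i ∈ univ.map e, Complex.normSq (correlation lam ψ i) := by
        rw [Finset.sum_map]
        rfl
    _ ≤ _ := Finset.sum_le_sum_of_subset_of_nonneg
        (fun i hi => by
          obtain ⟨j, -, rfl⟩ := Finset.mem_map.mp hi
          simp [e])
        fun i _ _ => Complex.normSq_nonneg _

end Correlation

theorem corollary2 (n d : ℕ) (hn : 3 ≤ n) (hd : 2 ≤ d)
    (lam : Fin (d ^ 2 - 1) → Matrix (Fin d) (Fin d) ℂ) (hlam : IsSUGenerators d lam)
    (ψ : EuclideanSpace ℂ (Fin n → Fin d)) (hψ : ‖ψ‖ = 1) :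
    entanglementMeasure lam ψ ≤ entanglementBound n d ∧
      entanglementMeasureNormalized lam ψ ≤ entanglementBound n d := by
  have hd' : (2 : ℝ) ≤ d := by exact_mod_cast hd
  have hbase : (1 : ℝ) ≤ (d : ℝ) / 2 := by linarith
  set c : ℝ := ((d : ℝ) / 2) ^ ((n : ℝ) / 2) with hc
  have hc1 : 1 ≤ c := Real.one_le_rpow hbase (by positivity)
  have hcc : ((d : ℝ) / 2) ^ n = c * c := by
    rw [hc, ← Real.rpow_add (by linarith), add_halves, Real.rpow_natCast]
  have hprod : ((d : ℝ) * ((d : ℝ) - 1) / 2) ^ ((n : ℝ) / 2) =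
      c * ((d : ℝ) - 1) ^ ((n : ℝ) / 2) := by
    rw [hc, ← Real.mul_rpow (by linarith) (by linarith)]
    congr 1
    ring
  have hnorm : c * ‖blochVector lam (pureState ψ)‖ ≤
      √((d : ℝ) ^ n - (n : ℝ) / ((n : ℝ) - 2) * (d : ℝ) ^ (n - 2) + 2 / ((n : ℝ) - 2)) := by
    apply Real.le_sqrt_of_sq_le
    rw [mul_pow, pow_two c, ← hcc]
    exact norm_blochVector_sq_le hn (by omega) hlam ψ hψ
  -- The correlation bound controls c‖T‖, which is what the prefactor c² needs. For the prefactor c,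
  -- the extra factor c ≥ 1, valid since d ≥ 2, is given away here.
  have hT : ‖blochVector lam (pureState ψ)‖ ≤ c * ‖blochVector lam (pureState ψ)‖ :=
    le_mul_of_one_le_left (norm_nonneg _) hc1
  have hc0 : 0 ≤ c := by linarith
  rw [entanglementMeasure, entanglementMeasureNormalized, entanglementBound, hprod, hcc, ← hc,
    mul_sub, mul_assoc]
  exact ⟨sub_le_sub_right (mul_le_mul_of_nonneg_left (hT.trans hnorm) hc0) _,
    sub_le_sub_right (mul_le_mul_of_nonneg_left hnorm hc0) _⟩
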